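/- Let $\mathbf p = 012102101021\cdots$ be the infinite word over $\{0,1,2\}$, with positions counted from $0$, that is the fixed point of the morphism $0\mapsto 01$, $1\mapsto 21$, $2\mapsto 0$. The appearance function $A(n)$ of $\mathbf p$ is the smallest positive integer $m$ such that every length-$n$ factor of $\mathbf p$ has an occurrence in $\mathbf p$ beginning at a position $\le m$. Let $X_1=1$, $X_2=2$, $X_3=4$, $X_4=7$ and $X_n=X_{n-1}+X_{n-2}+X_{n-4}$ for $n\ge 5$, and for a word of digits put $[e_t\cdots e_2e_1]_P=\sum_{1\le j\le t} e_jX_j$. Define sequences $(B_n)$ and $(C_n)$ by \begin{align*} B_{2i+3} &= [1(01)^i10]_P, & B_{2i+4} &= [1(01)^i100]_P,\\ C_{4i+2} &= [10(0010)^i]_P, & C_{4i+3} &= [10(0010)^i0]_P,\\ C_{4i+4} &= [10(0010)^i00]_P, & C_{4i+5} &= [10(0010)^i001]_P \end{align*} for $i\ge 0$. Then $$A(n)=\begin{cases} 2, & \text{if } n=1;\\ 4, & \text{if } n=2;\\ 7, & \text{if } n=3;\\ 11, & \text{if } n=4;\\ 13, & \text{if } n=5 \text{ or } n=6;\\ X_{2i+4}-1,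 & \text{if } B_{2i+1}<n\le C_{2i+2} \text{ for some } i\ge 1;\\ C_{2i+4}, & \text{if } C_{2i+2}<n<B_{2i+2} \text{ for some } i\ge 1;\\ X_{2i+5}-1, & \text{if } B_{2i+2}\le n\le C_{2i+3} \text{ for some } i\ge 1;\\ C_{2i+5}, & \text{if } C_{2i+3}<n\le B_{2i+3} \text{ for some } i\ge 1, \end{cases}$$ and every $n\ge 7$ falls under one of the last four cases. -/

import Mathlib

namespace PWord

/-- The morphism `0 ↦ 01`, `1 ↦ 21`, `2 ↦ 0` on letters. -/
def hLetter : Fin 3 → List (Fin 3)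
  | 0 => [0, 1]
  | 1 => [2, 1]
  | 2 => [0]

/-- The morphism `h` on finite words over `{0, 1, 2}`. -/
def h (w : List (Fin 3)) : List (Fin 3) := w.flatMap hLetter

/-- The infinite word `p = 012102101021012⋯` (positions counted from `0`), the fixed point of `h`:
its letter at position `n` is the letter of `h^n(0)` at position `n`. These words are prefixes of
one another and `h^n(0)` has more than `n` letters; `h_iterate_eq` and `h_prefix` below. -/
def p (n : ℕ) : Fin 3 := (h^[n] [0]).getD n 0

/-- The length-`n` factor of the infinite word `x` that begins at position `i`. -/
def factor {α : Type*} (x : ℕ → α) (i n : ℕ) : List α := (List.range n).map fun t => x (i + t)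

/-- The positive integers `m` such that every length-`n` factor of `x` has an occurrence that
begins at a position `≤ m`. -/
def appearanceBounds {α : Type*} (x : ℕ → α) (n : ℕ) : Set ℕ :=
  {m | 0 < m ∧ ∀ i, ∃ j ≤ m, factor x j n = factor x i n}

/-- The appearance function of `x`: the least element of `appearanceBounds x n`. -/
noncomputable def appearance {α : Type*} (x : ℕ → α) (n : ℕ) : ℕ := sInf (appearanceBounds x n)

/-- The recurrence `X₁ = 1, X₂ = 2, X₃ = 4, X₄ = 7`, `Xₙ = Xₙ₋₁ + Xₙ₋₂ + Xₙ₋₄` for `n ≥ 5`.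
(The value at `0` is never used.) -/
def X : ℕ → ℕ
  | 0 => 1
  | 1 => 1
  | 2 => 2
  | 3 => 4
  | 4 => 7
  | n + 5 => X (n + 4) + X (n + 3) + X (n + 1)

/-- The value `[e_t ⋯ e_2 e_1]_P = ∑ e_i X_i` of a word of digits, most significant digit first. -/
def valP : List ℕ → ℕ
  | [] => 0
  | e :: w => e * X (w.length + 1) + valP w

/-- The power `w ^ i` of a finite word. -/
def wpow (w : List ℕ) (i : ℕ) : List ℕ := (List.replicate i w).flatten

/-- `B_{2i+3} = [1(01)^i 10]_P`, `B_{2i+4} = [1(01)^i 100]_P`, see `B_odd`, `B_even`.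
(The values at `n < 3` are never used.) -/
def B (n : ℕ) : ℕ :=
  if n % 2 = 1 then valP ([1] ++ wpow [0, 1] ((n - 3) / 2) ++ [1, 0])
  else valP ([1] ++ wpow [0, 1] ((n - 4) / 2) ++ [1, 0, 0])

/-- `C_{4i+2}, C_{4i+3}, C_{4i+4}, C_{4i+5}` are the values of `10(0010)^i` followed by the empty
word, `0`, `00`, `001`, respectively, see `C_two`, `C_three`, `C_four`, `C_five`.
(The values at `n < 2` are never used.) -/
def C (n : ℕ) : ℕ :=
  valP ([1, 0] ++ wpow [0, 0, 1, 0] ((n - 2) / 4) ++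
    (if n % 4 = 2 then [] else if n % 4 = 3 then [0] else if n % 4 = 0 then [0, 0] else [0, 0, 1]))

theorem B_odd (i : ℕ) : B (2 * i + 3) = valP ([1] ++ wpow [0, 1] i ++ [1, 0]) := by
  have h1 : (2 * i + 3) % 2 = 1 := by omega
  have h2 : (2 * i + 3 - 3) / 2 = i := by omega
  simp only [B, h1, h2, if_true]

theorem B_even (i : ℕ) : B (2 * i + 4) = valP ([1] ++ wpow [0, 1] i ++ [1, 0, 0]) := by
  have h1 : (2 * i + 4) % 2 ≠ 1 := by omega
  have h2 : (2 * i + 4 - 4) / 2 = i := by omega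
  rw [B, if_neg h1, h2]

theorem C_two (i : ℕ) : C (4 * i + 2) = valP ([1, 0] ++ wpow [0, 0, 1, 0] i) := by
  have h1 : (4 * i + 2) % 4 = 2 := by omega
  have h2 : (4 * i + 2 - 2) / 4 = i := by omega
  simp only [C, h1, h2]; simp

theorem C_three (i : ℕ) : C (4 * i + 3) = valP ([1, 0] ++ wpow [0, 0, 1, 0] i ++ [0]) := by
  have h1 : (4 * i + 3) % 4 = 3 := by omega
  have h2 : (4 * i + 3 - 2) / 4 = i := by omega
  simp only [C, h1, h2]; simp

theorem C_four (i : ℕ) : C (4 * i + 4) = valP ([1, 0] ++ wpow [0, 0, 1, 0] i ++ [0, 0]) := by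
  have h1 : (4 * i + 4) % 4 = 0 := by omega
  have h2 : (4 * i + 4 - 2) / 4 = i := by omega
  simp only [C, h1, h2]; simp

theorem C_five (i : ℕ) : C (4 * i + 5) = valP ([1, 0] ++ wpow [0, 0, 1, 0] i ++ [0, 0, 1]) := by
  have h1 : (4 * i + 5) % 4 = 1 := by omega
  have h2 : (4 * i + 5 - 2) / 4 = i := by omega
  simp only [C, h1, h2]; simp

/-- Over a finite alphabet the appearance function is a genuine minimum. -/
theorem isLeast_appearance {α : Type*} [Finite α] (x : ℕ → α) (n : ℕ) :
    IsLeast (appearanceBounds x n) (appearance x n) := by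
  have hne : (appearanceBounds x n).Nonempty := by
    have hfin : (Set.range fun i => factor x i n).Finite := by
      refine (List.finite_length_eq α n).subset ?_
      rintro _ ⟨i, rfl⟩
      simp [factor]
    choose! g hg using fun (w : List α) (hw : w ∈ Set.range fun i => factor x i n) => hw
    obtain ⟨m, hm⟩ := (hfin.image g).bddAbove
    refine ⟨m + 1, Nat.succ_pos _, fun i => ⟨g (factor x i n), ?_, hg _ ⟨i, rfl⟩⟩⟩
    exact (hm ⟨_, ⟨i, rfl⟩, rfl⟩).trans (Nat.le_succ m)
  exact ⟨Nat.sInf_mem hne, fun m hm => Nat.sInf_le hm⟩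

theorem h_append (u v : List (Fin 3)) : h (u ++ v) = h u ++ h v := by simp [h]

theorem h_iterate_append (k : ℕ) (u v : List (Fin 3)) :
    h^[k] (u ++ v) = h^[k] u ++ h^[k] v := by
  induction k generalizing u v with
  | zero => rfl
  | succ k ih => simp only [Function.iterate_succ_apply, h_append, ih]

theorem length_h (w : List (Fin 3)) : w.length ≤ (h w).length := by
  induction w with
  | nil => simp
  | cons a w ih =>
    have : h (a :: w) = hLetter a ++ h w := by simp [h]
    rw [this, List.length_append, List.length_cons]
    fin_cases a <;> simp [hLetter] <;> omega

theorem length_h_iterate (k : ℕ) (w : List (Fin 3)) : w.length ≤ (h^[k] w).length := by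
  induction k generalizing w with
  | zero => simp
  | succ k ih => exact (length_h w).trans (by simpa using ih (h w))

theorem h_iterate_succ (k : ℕ) : h^[k + 1] [0] = h^[k] [0] ++ h^[k] [1] := by
  rw [Function.iterate_succ_apply, ← h_iterate_append]
  rfl

theorem lt_length_h_iterate (k : ℕ) : k < (h^[k] [0]).length := by
  induction k with
  | zero => simp
  | succ k ih =>
    have := length_h_iterate k [1]
    rw [h_iterate_succ, List.length_append]
    simp at this
    omega

theorem h_iterate_prefix {k l : ℕ} (hkl : k ≤ l) : h^[k] [0] <+: h^[l] [0] := by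
  induction l, hkl using Nat.le_induction with
  | base => exact List.prefix_refl _
  | succ l _ ih => exact ih.trans (by rw [h_iterate_succ]; exact List.prefix_append _ _)

theorem getElem_h_iterate (k n : ℕ) (hn : n < (h^[k] [0]).length) : (h^[k] [0])[n] = p n := by
  have hn' := lt_length_h_iterate n
  rw [p, List.getD_eq_getElem _ _ hn']
  rcases le_total k n with hk | hk
  · exact (h_iterate_prefix hk).getElem hn
  · exact ((h_iterate_prefix hk).getElem hn').symm

/-- Every `h^k(0)` is a prefix of `p`. -/
theorem h_iterate_eq (k : ℕ) : h^[k] [0] = factor p 0 (h^[k] [0]).length := by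
  apply List.ext_getElem
  · simp [factor]
  · intro n h1 h2
    rw [getElem_h_iterate k n h1]
    simp [factor]

/-- `p` is a fixed point of `h`: the image under `h` of each prefix of `p` is a prefix of `p`. -/
theorem h_prefix (n : ℕ) :
    h (factor p 0 n) = factor p 0 (h (factor p 0 n)).length := by
  have hpre : ∀ m l, m ≤ l → factor p 0 m <+: factor p 0 l := by
    intro m l hml
    have : List.range m <+: List.range l := by
      obtain ⟨d, rfl⟩ := Nat.exists_eq_add_of_le hml
      rw [List.range_add]
      exact List.prefix_append _ _
    exact this.map _
  have h1 : factor p 0 n <+: h^[n] [0] := by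
    rw [h_iterate_eq n]
    exact hpre _ _ (lt_length_h_iterate n).le
  have h2 : h (factor p 0 n) <+: factor p 0 (h^[n + 1] [0]).length := by
    rw [← h_iterate_eq, Function.iterate_succ_apply']
    obtain ⟨t, ht⟩ := h1
    rw [← ht, h_append]
    exact List.prefix_append _ _
  have hlen : (h (factor p 0 n)).length ≤ (h^[n + 1] [0]).length := by
    simpa [factor] using h2.length_le
  exact (List.prefix_of_prefix_length_le h2 (hpre _ _ hlen) (by simp [factor])).eq_of_length
    (by simp [factor])

end PWord

open PWord

/-! Let `H n` be the length of the image of the prefix of length `n`. The images `01`, `21`, `0` can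
be read back: a letter other than `1` begins an image and a `1` ends one. Hence both repetitions and
first occurrences of factors pass through `h`, their ends shifting by at most one letter.

`H` sends `X k` to `X (k+1)`, and up to one letter it sends `cs k` to `cs (k+1)` and `es k` to `es
(k+1)`. Applying `h` repeatedly therefore gives two families of repetitions (`match_X`, `match_cs`)
and two of first occurrences (`isNew_X`, `isNew_cs`).

For `X (q+3) ≤ m < X (q+4)`, the repetitions show that the factor at `m` occurs earlier if its
length is at most `cs (q+1)` when `m ≤ cs (q+3)`, or at most `es (q+1) + 1` when `m` is larger. So
the last indispensable start is `cs (k+3)` for `cs (k+1) < n ≤ es (k+1) + 1` and `X (k+4) - 1` for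
`es (k+1) + 1 < n ≤ cs (k+2)`; the first occurrences show that neither can be lowered. These ranges
tile the integers from 2 on, and `B`, `C` encode their ends. -/

namespace PWord

/-! ### Reading `p` back through the morphism -/

/-- The length of the image under `h` of the prefix of `p` of length `n`. -/
def H (n : ℕ) : ℕ := (h (factor p 0 n)).length

theorem factor_zero_succ (n : ℕ) : factor p 0 (n + 1) = factor p 0 n ++ [p n] := by
  simp [factor, List.range_succ]

theorem h_factor_succ (n : ℕ) :
    h (factor p 0 (n + 1)) = h (factor p 0 n) ++ hLetter (p n) := by
  rw [factor_zero_succ, h_append]; simp [h]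

theorem H_zero : H 0 = 0 := by simp [H, factor, h]

theorem H_succ (n : ℕ) : H (n + 1) = H n + (hLetter (p n)).length := by
  rw [H, h_factor_succ, List.length_append, H]

theorem p_H_add (n s : ℕ) (hs : s < (hLetter (p n)).length) :
    p (H n + s) = (hLetter (p n))[s] := by
  have h1 := h_prefix (n + 1)
  have h2 : H n + s < (h (factor p 0 (n + 1))).length := by
    rw [h_factor_succ, List.length_append, ← H]; omega
  have h3 : (h (factor p 0 (n + 1)))[H n + s] = p (H n + s) := by
    have : (h (factor p 0 (n + 1)))[H n + s]? = some (p (H n + s)) := by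
      rw [h1, factor, List.getElem?_map, List.getElem?_range h2]
      simp
    rw [List.getElem?_eq_getElem h2] at this
    exact Option.some.inj this
  rw [← h3]
  simp only [h_factor_succ]
  rw [List.getElem_append_right (by simp [H])]
  simp [H]

theorem fin_three (a : Fin 3) : a = 0 ∨ a = 1 ∨ a = 2 := by
  fin_cases a <;> simp

theorem H_succ_of_ne {n : ℕ} (hn : p n ≠ 2) : H (n + 1) = H n + 2 := by
  rw [H_succ]
  rcases fin_three (p n) with e | e | e
  · simp [e, hLetter]
  · simp [e, hLetter]
  · exact absurd e hn

theorem H_succ_of_two {n : ℕ} (hn : p n = 2) : H (n + 1) = H n + 1 := by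
  rw [H_succ, hn]; rfl

theorem p_H (n : ℕ) : p (H n) = if p n = 1 then 2 else 0 := by
  have h0 : 0 < (hLetter (p n)).length := by
    rcases fin_three (p n) with e | e | e <;> simp [e, hLetter]
  have := p_H_add n 0 h0
  rw [Nat.add_zero] at this
  rw [this]
  rcases fin_three (p n) with e | e | e <;> simp [e, hLetter]

theorem p_H_of_one {n : ℕ} (hn : p n = 1) : p (H n) = 2 := by rw [p_H, if_pos hn]

theorem p_H_of_ne {n : ℕ} (hn : p n ≠ 1) : p (H n) = 0 := by rw [p_H, if_neg hn]

theorem p_H_ne_one (n : ℕ) : p (H n) ≠ 1 := by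
  rw [p_H]; split_ifs <;> decide

theorem p_H_succ {n : ℕ} (hn : p n ≠ 2) : p (H n + 1) = 1 := by
  have h0 : 1 < (hLetter (p n)).length := by
    rcases fin_three (p n) with e | e | e <;> simp [e, hLetter] at hn ⊢
  rw [p_H_add n 1 h0]
  rcases fin_three (p n) with e | e | e <;> simp [e, hLetter] at hn ⊢

theorem H_strictMono : StrictMono H := by
  refine strictMono_nat_of_lt_succ fun n => ?_
  by_cases hn : p n = 2
  · rw [H_succ_of_two hn]; omega
  · rw [H_succ_of_ne hn]; omega

theorem exists_eq_H (m : ℕ) : ∃ n, m = H n ∨ (m = H n + 1 ∧ p n ≠ 2) := by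
  induction m with
  | zero => exact ⟨0, Or.inl H_zero.symm⟩
  | succ m ih =>
    obtain ⟨n, e | ⟨e, hn⟩⟩ := ih
    · by_cases hn : p n = 2
      · exact ⟨n + 1, Or.inl (by rw [H_succ_of_two hn, e])⟩
      · exact ⟨n, Or.inr ⟨by rw [e], hn⟩⟩
    · exact ⟨n + 1, Or.inl (by rw [H_succ_of_ne hn, e])⟩

theorem exists_eq_H_of_ne {m : ℕ} (hm : p m ≠ 1) : ∃ n, m = H n := by
  obtain ⟨n, e | ⟨e, hn⟩⟩ := exists_eq_H m
  · exact ⟨n, e⟩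
  · exact absurd (by rw [e, p_H_succ hn]) hm

theorem exists_eq_H_of_one {m : ℕ} (hm : p m = 1) : ∃ n, m = H n + 1 ∧ p n ≠ 2 := by
  obtain ⟨n, e | e⟩ := exists_eq_H m
  · exact absurd (e ▸ hm) (p_H_ne_one n)
  · exact ⟨n, e⟩

theorem p_succ_of_two {n : ℕ} (hn : p n = 2) : p (n + 1) = 1 := by
  obtain ⟨i, rfl⟩ := exists_eq_H_of_ne (m := n) (by rw [hn]; decide)
  apply p_H_succ
  intro hi
  rw [p_H_of_ne (by rw [hi]; decide)] at hn
  exact absurd hn (by decide)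

theorem p_succ_of_one {n : ℕ} (hn : p n = 1) : p (n + 1) ≠ 1 := by
  obtain ⟨i, rfl, hi⟩ := exists_eq_H_of_one hn
  have := p_H_ne_one (i + 1)
  rwa [H_succ_of_ne hi] at this

theorem p_succ_of_zero {n : ℕ} (hn : p n = 0) : p (n + 1) ≠ 0 := by
  obtain ⟨i, rfl⟩ := exists_eq_H_of_ne (m := n) (by rw [hn]; decide)
  by_cases hi : p i = 2
  · rw [← H_succ_of_two hi, p_H_of_one (p_succ_of_two hi)]; decide
  · rw [p_H_succ hi]; decide

/-! ### Transport of matches and mismatches through the morphism -/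

/-- The length-`n` factors of `p` at `j` and `m` agree. -/
def Match (j m n : ℕ) : Prop := ∀ s < n, p (j + s) = p (m + s)

/-- The suffixes of `p` at `j` and `m` differ no later than at position `e` of the latter. -/
def Mis (j m e : ℕ) : Prop := ∃ t, m + t ≤ e ∧ p (j + t) ≠ p (m + t)

/-- The factor of `p` on `[m, e]` does not begin before `m`. -/
def IsNew (m e : ℕ) : Prop := ∀ j < m, Mis j m e

theorem Match.mono {j m n n' : ℕ} (hM : Match j m n) (hn : n' ≤ n) : Match j m n' :=
  fun s hs => hM s (by omega)

theorem Match.drop {j m n : ℕ} (hM : Match j m n) (d : ℕ) : Match (j + d) (m + d) (n - d) := by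
  intro s hs
  have := hM (d + s) (by omega)
  simpa [Nat.add_assoc] using this

theorem Match.factor_eq {j m n : ℕ} (hM : Match j m n) : factor p j n = factor p m n := by
  simp only [factor]
  refine List.map_congr_left fun s hs => hM s (List.mem_range.1 hs)

theorem match_of_factor_eq {j m n : ℕ} (hf : factor p j n = factor p m n) : Match j m n := by
  intro s hs
  simp only [factor] at hf
  exact List.map_inj_left.1 hf s (List.mem_range.2 hs)

theorem Match.map {j m n : ℕ} (hM : Match j m n) :
    ∃ d, H (j + n) = H j + d ∧ H (m + n) = H m + d ∧ Match (H j) (H m) d := by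
  induction n with
  | zero => exact ⟨0, rfl, rfl, fun s hs => absurd hs (Nat.not_lt_zero s)⟩
  | succ n ih =>
    obtain ⟨d, h1, h2, h3⟩ := ih (hM.mono n.le_succ)
    have hl := hM n n.lt_succ_self
    refine ⟨d + (hLetter (p (m + n))).length, ?_, ?_, ?_⟩
    · rw [← Nat.add_assoc, H_succ, h1, hl, Nat.add_assoc]
    · rw [← Nat.add_assoc, H_succ, h2, Nat.add_assoc]
    · intro s hs
      by_cases hsd : s < d
      · exact h3 s hsd
      · obtain ⟨r, rfl⟩ := Nat.exists_eq_add_of_le (not_lt.1 hsd)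
        have hr : r < (hLetter (p (m + n))).length := by omega
        have e1 := p_H_add (j + n) r (by rw [hl]; exact hr)
        have e2 := p_H_add (m + n) r hr
        rw [← Nat.add_assoc, ← Nat.add_assoc, ← h1, ← h2, e1, e2]
        simp only [hl]

/-- If the matched factor ends with `1`, its image can be extended by one letter. -/
theorem Match.map_of_one {j m n : ℕ} (hM : Match j m (n + 1)) (h1 : p (m + n) = 1) :
    ∃ d, H (j + n + 1) = H j + d ∧ H (m + n + 1) = H m + d ∧ Match (H j) (H m) (d + 1) := by
  obtain ⟨d, e1, e2, h3⟩ := hM.map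
  refine ⟨d, e1, e2, fun s hs => ?_⟩
  rcases Nat.lt_succ_iff_lt_or_eq.1 hs with h | rfl
  · exact h3 s h
  · rw [← e1, ← e2, p_H_of_ne, p_H_of_ne]
    · exact p_succ_of_one h1
    · exact p_succ_of_one ((hM n n.lt_succ_self).trans h1)

/-- Only the images `01` and `0` share a first letter. What follows the image `0` begins another
image, so it is not `1`. -/
theorem H_ne_of_ne {a b : ℕ} (hab : p a ≠ p b) : ∃ s ≤ 1, p (H a + s) ≠ p (H b + s) := by
  by_cases ha : p a = 1
  · refine ⟨0, by omega, ?_⟩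
    rw [Nat.add_zero, Nat.add_zero, p_H_of_one ha, p_H_of_ne (fun hb => hab (ha.trans hb.symm))]
    decide
  by_cases hb : p b = 1
  · refine ⟨0, by omega, ?_⟩
    rw [Nat.add_zero, Nat.add_zero, p_H_of_one hb, p_H_of_ne ha]
    decide
  refine ⟨1, le_rfl, ?_⟩
  by_cases ha2 : p a = 2
  · have hb2 : p b ≠ 2 := fun hb2 => hab (ha2.trans hb2.symm)
    rw [p_H_succ hb2, ← H_succ_of_two ha2]
    exact p_H_ne_one _
  · by_cases hb2 : p b = 2
    · rw [p_H_succ ha2, ← H_succ_of_two hb2]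
      exact (p_H_ne_one _).symm
    · exfalso
      rcases fin_three (p a) with e | e | e <;> rcases fin_three (p b) with f | f | f <;>
        simp_all

theorem Mis.exists_first {j m e : ℕ} (hM : Mis j m e) :
    ∃ t, m + t ≤ e ∧ p (j + t) ≠ p (m + t) ∧ Match j m t := by
  classical
  have hex : ∃ t, p (j + t) ≠ p (m + t) := ⟨hM.choose, hM.choose_spec.2⟩
  refine ⟨Nat.find hex, ?_, Nat.find_spec hex, fun s hs => not_not.1 (Nat.find_min hex hs)⟩
  have := Nat.find_min' hex hM.choose_spec.2
  have := hM.choose_spec.1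
  omega

theorem Mis.map {j m e : ℕ} (hM : Mis j m e) : Mis (H j) (H m) (H e + 1) := by
  obtain ⟨t, ht, hne, hm⟩ := hM.exists_first
  obtain ⟨d, e1, e2, -⟩ := hm.map
  obtain ⟨s, hs, hne'⟩ := H_ne_of_ne hne
  have := H_strictMono.monotone ht
  refine ⟨d + s, by omega, ?_⟩
  rwa [← Nat.add_assoc, ← Nat.add_assoc, ← e1, ← e2]

/-- Saves one letter over `Mis.map`: after `0` only `1` and `2` are possible, and their images
differ at once. -/
theorem Mis.map_of_zero {j m u : ℕ} (hM : Mis j m (u + 1)) (hmu : m ≤ u) (hu : p u = 0) :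
    Mis (H j) (H m) (H (u + 1)) := by
  obtain ⟨t, ht, hne, hm⟩ := hM.exists_first
  obtain ⟨d, e1, e2, -⟩ := hm.map
  rcases Nat.lt_or_ge (m + t) (u + 1) with hlt | hge
  · obtain ⟨s, hs, hne'⟩ := H_ne_of_ne hne
    have := H_strictMono hlt
    refine ⟨d + s, by omega, ?_⟩
    rwa [← Nat.add_assoc, ← Nat.add_assoc, ← e1, ← e2]
  · have hmt : m + t = u + 1 := le_antisymm ht hge
    refine ⟨d, by rw [← e2, hmt], ?_⟩
    rw [← e1, ← e2]
    obtain ⟨r, rfl⟩ : ∃ r, t = r + 1 := ⟨t - 1, by omega⟩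
    have hmr : m + r = u := by omega
    have hb := p_succ_of_zero (n := m + r) (by rw [hmr, hu])
    have ha := p_succ_of_zero (n := j + r) (by rw [hm r r.lt_succ_self, hmr, hu])
    rw [← Nat.add_assoc, ← Nat.add_assoc] at *
    rw [p_H, p_H]
    rcases fin_three (p (j + r + 1)) with e | e | e <;>
      rcases fin_three (p (m + r + 1)) with f | f | f <;> simp_all

theorem IsNew.map {m e e' : ℕ} (hN : IsNew m e)
    (hM : ∀ j, Mis j m e → Mis (H j) (H m) e') (he : H m ≤ e') : IsNew (H m) e' := by
  intro j hj
  by_cases h1 : p j = 1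
  · exact ⟨0, by simpa using he, by
      rw [Nat.add_zero, Nat.add_zero, h1]; exact (p_H_ne_one m).symm⟩
  · obtain ⟨i, rfl⟩ := exists_eq_H_of_ne h1
    exact hM i (hN i (H_strictMono.lt_iff_lt.1 hj))

/-- Starting at the final `1` of an image hides whether it was `01` or `21`. The next letter
recovers this: `0` is never followed by `0`, nor `1` by `1`, and `2` is excluded at `m + 1`. -/
theorem IsNew.map_succ {m e e' : ℕ} (hN : IsNew m e) (hm : p m ≠ 2) (hm1 : p (m + 1) ≠ 2)
    (hme : m + 1 ≤ e) (hM : ∀ j, Mis j (m + 1) e → Mis (H j) (H (m + 1)) e')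
    (he : H m + 1 ≤ e') : IsNew (H m + 1) e' := by
  intro j hj
  by_cases h1 : p j = 1
  · obtain ⟨i, rfl, hi⟩ := exists_eq_H_of_one h1
    have hi' : i < m := H_strictMono.lt_iff_lt.1 (by omega)
    have hmis : Mis (i + 1) (m + 1) e := by
      obtain ⟨t, ht, hne⟩ := hN i hi'
      rcases t with _ | t
      · refine ⟨0, by simpa using hme, ?_⟩
        simp only [Nat.add_zero] at hne ⊢
        intro heq
        have a0 := @p_succ_of_zero i
        have a1 := @p_succ_of_one i
        have b0 := @p_succ_of_zero m
        have b1 := @p_succ_of_one m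
        rcases fin_three (p i) with e | e | e <;> rcases fin_three (p m) with f | f | f <;>
          rcases fin_three (p (m + 1)) with g | g | g <;> simp_all
      · refine ⟨t, by omega, ?_⟩
        rwa [Nat.add_assoc i, Nat.add_assoc m, Nat.add_comm 1 t]
    obtain ⟨t, ht, hne⟩ := hM _ hmis
    rw [H_succ_of_ne hm] at ht hne
    rw [H_succ_of_ne hi] at hne
    refine ⟨t + 1, by omega, ?_⟩
    rwa [show H i + 1 + (t + 1) = H i + 2 + t by omega,
      show H m + 1 + (t + 1) = H m + 2 + t by omega]
  · exact ⟨0, by simpa using he, by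
      rw [Nat.add_zero, Nat.add_zero, p_H_succ hm]; exact h1⟩

/-! ### Arithmetic of the sequences `X`, `cs` and `es` -/

theorem X_add_five (n : ℕ) : X (n + 5) = X (n + 4) + X (n + 3) + X (n + 1) := by
  rw [X]

/-- Reflects the factorization `x^4 - x^3 - x^2 - 1 = (x + 1)(x^3 - 2x^2 + x - 1)`; this shorter
recurrence is the one the lengths of `h^k(0)` satisfy directly. -/
theorem X_add_four_add (n : ℕ) : X (n + 4) + X (n + 2) = 2 * X (n + 3) + X (n + 1) := by
  induction n with
  | zero => rfl
  | succ n ih =>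
    have := X_add_five n
    show X (n + 5) + X (n + 3) = 2 * X (n + 4) + X (n + 2)
    omega

theorem X_pos (n : ℕ) : 0 < X n := by
  induction n using Nat.strong_induction_on with
  | _ n ih =>
    match n with
    | 0 | 1 | 2 | 3 | 4 => decide
    | n + 5 =>
      have := ih (n + 4) (by omega)
      rw [X_add_five]; omega

theorem X_lt_succ (n : ℕ) : X (n + 1) < X (n + 2) := by
  match n with
  | 0 | 1 | 2 => decide
  | n + 3 =>
    have := X_add_five n
    have := X_pos (n + 1)
    have := X_pos (n + 3)
    show X (n + 4) < X (n + 5)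
    omega

theorem X_succ_mono {a b : ℕ} (hab : a ≤ b) : X (a + 1) ≤ X (b + 1) :=
  monotone_nat_of_le_succ (f := fun n => X (n + 1)) (fun n => (X_lt_succ n).le) hab

theorem add_le_X (n : ℕ) : n + 1 ≤ X (n + 1) := by
  induction n with
  | zero => decide
  | succ n ih =>
    have := X_lt_succ n
    show n + 2 ≤ X (n + 2)
    omega

theorem length_h_iterate_zero (k : ℕ) : (h^[k] [0]).length = X (k + 1) := by
  have e1 : ∀ k, h^[k + 1] [1] = h^[k] [2] ++ h^[k] [1] := fun k => by
    rw [Function.iterate_succ_apply, ← h_iterate_append]; rfl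
  have e2 : ∀ k, h^[k + 1] [2] = h^[k] [0] := fun k => by
    rw [Function.iterate_succ_apply]; rfl
  have l0 : ∀ k, (h^[k + 1] [0]).length = (h^[k] [0]).length + (h^[k] [1]).length :=
    fun k => by rw [h_iterate_succ, List.length_append]
  have l1 : ∀ k, (h^[k + 2] [1]).length = (h^[k] [0]).length + (h^[k + 1] [1]).length :=
    fun k => by rw [e1, e2, List.length_append]
  induction k using Nat.strong_induction_on with
  | _ k ih =>
    match k with
    | 0 | 1 | 2 => decide
    | k + 3 =>
      have i0 := ih k (by omega)
      have i1 := ih (k + 1) (by omega)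
      have i2 := ih (k + 2) (by omega)
      have := l0 (k + 2)
      have := l0 (k + 1)
      have := l1 k
      have hX := X_add_four_add k
      simp only [Nat.add_assoc, Nat.reduceAdd] at *
      omega

theorem H_X (k : ℕ) : H (X (k + 1)) = X (k + 2) := by
  rw [H, ← length_h_iterate_zero, ← h_iterate_eq, ← Function.iterate_succ_apply' h,
    length_h_iterate_zero]

/-- The sums `X n + X (n - 4) + X (n - 8) + ⋯` (over positive indices). -/
def cs : ℕ → ℕ
  | 0 => 0
  | 1 => 1
  | 2 => 2
  | 3 => 4
  | n + 4 => X (n + 4) + cs n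

/-- The sums `X n + X (n - 2) + X (n - 4) + ⋯` (over positive indices). -/
def es : ℕ → ℕ
  | 0 => 0
  | 1 => 1
  | n + 2 => X (n + 2) + es n

theorem cs_add_four (n : ℕ) : cs (n + 4) = X (n + 4) + cs n := by rw [cs]

theorem es_add_two (n : ℕ) : es (n + 2) = X (n + 2) + es n := by rw [es]

theorem es_eq (n : ℕ) : es (n + 2) = cs (n + 2) + cs n := by
  induction n using Nat.strong_induction_on with
  | _ n ih =>
    match n with
    | 0 | 1 => decide
    | n + 2 =>
      rw [es_add_two, ih n (by omega), cs_add_four]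
      show X (n + 4) + _ = _
      omega

theorem cs_sub (n : ℕ) : cs (n + 2) + X (n + 2) = X (n + 3) + cs n := by
  induction n using Nat.strong_induction_on with
  | _ n ih =>
    match n with
    | 0 | 1 | 2 | 3 => decide
    | n + 4 =>
      have := ih n (by omega)
      have h1 := cs_add_four n
      have h2 := cs_add_four (n + 2)
      have h3 := X_add_five (n + 2)
      have h4 := X_add_four_add (n + 1)
      have h5 := X_add_five n
      have h6 := X_add_five (n + 1)
      have h7 := X_add_four_add n
      have h8 := X_add_four_add (n + 2)
      have h9 := X_add_four_add (n + 3)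
      simp only [Nat.add_assoc, Nat.reduceAdd] at *
      omega

/-- Locates the end of the repeated block in `match_cs`, which is `2 * cs (n + 3)` (exclusive). -/
theorem two_mul_cs (n : ℕ) : 2 * cs (n + 3) = X (n + 4) + es (n + 1) := by
  have h1 := cs_sub (n + 1)
  match n with
  | 0 => decide
  | n + 1 =>
    have h2 := es_eq n
    have h3 := cs_add_four n
    simp only [Nat.add_assoc, Nat.reduceAdd] at *
    omega

theorem X_add_le (n : ℕ) : X (n + 3) + X (n + 2) ≤ X (n + 4) := by
  match n with
  | 0 => decide
  | n + 1 =>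
    have := X_add_five n
    show X (n + 4) + X (n + 3) ≤ X (n + 5)
    omega

theorem es_lt (n : ℕ) : es n < X (n + 1) := by
  induction n using Nat.strong_induction_on with
  | _ n ih =>
    match n with
    | 0 | 1 | 2 => decide
    | n + 3 =>
      have : es (n + 1) < X (n + 2) := ih (n + 1) (by omega)
      have := X_add_le n
      rw [es_add_two]
      show X (n + 3) + es (n + 1) < X (n + 4)
      omega

theorem X_le_cs (n : ℕ) : X (n + 1) ≤ cs (n + 1) := by
  match n with
  | 0 | 1 | 2 => decide
  | n + 3 =>
    show X (n + 4) ≤ cs (n + 4)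
    rw [cs_add_four]; omega

theorem cs_le_es (n : ℕ) : cs n ≤ es n := by
  match n with
  | 0 | 1 => decide
  | n + 2 => have := es_eq n; omega

theorem es_lt_cs (n : ℕ) : es n < cs (n + 1) :=
  (es_lt n).trans_le (X_le_cs n)

theorem cs_lt (n : ℕ) : cs n < cs (n + 1) := (cs_le_es n).trans_lt (es_lt_cs n)

theorem cs_mono {a b : ℕ} (hab : a ≤ b) : cs a ≤ cs b :=
  monotone_nat_of_le_succ (fun n => (cs_lt n).le) hab

theorem es_mono {a b : ℕ} (hab : a ≤ b) : es a ≤ es b :=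
  monotone_nat_of_le_succ (fun n => (es_lt_cs n).le.trans (cs_le_es _)) hab

theorem es_pos (n : ℕ) : 0 < es (n + 1) :=
  (X_pos _).trans_le ((X_le_cs n).trans (cs_le_es _))

/-! ### Repetitions in `p` -/

theorem p_zero : p 0 = 0 := by decide
theorem p_one : p 1 = 1 := by decide
theorem p_four : p 4 = 0 := by decide
theorem H_one : H 1 = 2 := by decide
theorem H_two : H 2 = 4 := by decide

/-- The letter of `p` just before position `es k` is `1` for even `k` and `0` for odd `k`. -/
def EsLetter (k : ℕ) : Prop :=
  ∃ u, es k = u + 1 ∧ (k % 2 = 0 ∧ p u = 1 ∨ k % 2 = 1 ∧ p u = 0)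

/-- The three claims need each other. The last letter of the matched prefix decides whether its
image gains a letter; the match copies that letter and the value of `H` from `es (n+1)` to `es
(n+3)`. Steps of two force two consecutive indices to be carried. -/
theorem es_induction (n : ℕ) :
    Match 0 (X (n + 3)) (es (n + 1)) ∧
    (es (n + 2) + (n + 1) % 2 = H (es (n + 1)) + 1 ∧
      es (n + 3) + (n + 2) % 2 = H (es (n + 2)) + 1) ∧
    EsLetter (n + 1) ∧ EsLetter (n + 2) := by
  induction n with
  | zero =>
    refine ⟨?_, ⟨?_, ?_⟩, ⟨0, rfl, Or.inr ⟨rfl, p_zero⟩⟩, ⟨1, rfl, Or.inl ⟨rfl, p_one⟩⟩⟩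
    · intro s hs
      obtain rfl : s = 0 := by
        have : es (0 + 1) = 1 := rfl
        omega
      exact p_zero.trans p_four.symm
    · rw [show es (0 + 1) = 1 from rfl, H_one]; rfl
    · rw [show es (0 + 2) = 2 from rfl, H_two]; rfl
  | succ n ih =>
    obtain ⟨hM, ⟨hH1, hH2⟩, hL1, hL2⟩ := ih
    obtain ⟨u, hu, hL⟩ := hL1
    refine ⟨?_, ⟨hH2, ?_⟩, hL2, u + X (n + 3), ?_, ?_⟩
    · show Match 0 (X (n + 4)) (es (n + 2))
      rw [← H_X (n + 2), ← H_zero]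
      rcases hL with ⟨he, hp⟩ | ⟨ho, hp⟩
      · rw [hu] at hM
        obtain ⟨d, e1, e2, h3⟩ := hM.map_of_one (by rw [← hM u u.lt_succ_self, Nat.zero_add, hp])
        rw [H_zero, Nat.zero_add, Nat.zero_add] at e1
        rw [hu] at hH1
        exact h3.mono (by omega)
      · obtain ⟨d, e1, e2, h3⟩ := hM.map
        rw [H_zero, Nat.zero_add, Nat.zero_add] at e1
        exact h3.mono (by omega)
    · obtain ⟨d, e1, e2, -⟩ := hM.map
      rw [H_zero, Nat.zero_add, Nat.zero_add] at e1
      rw [H_X] at e2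
      show es (n + 4) + (n + 3) % 2 = H (es (n + 3)) + 1
      rw [es_add_two (n + 2), es_add_two (n + 1), e2, ← e1]
      show X (n + 4) + es (n + 2) + (n + 3) % 2 = X (n + 4) + H (es (n + 1)) + 1
      omega
    · show es (n + 3) = _
      rw [es_add_two (n + 1), hu]
      show X (n + 3) + (u + 1) = _
      omega
    · have := hM u (by omega)
      rw [Nat.zero_add] at this
      rw [Nat.add_comm u, ← this]
      show (n + 3) % 2 = 0 ∧ _ ∨ (n + 3) % 2 = 1 ∧ _
      rcases hL with h | h
      · exact Or.inl ⟨by omega, h.2⟩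
      · exact Or.inr ⟨by omega, h.2⟩

theorem match_X (n : ℕ) : Match 0 (X (n + 3)) (es (n + 1)) := (es_induction n).1

theorem H_es (n : ℕ) : es (n + 2) + (n + 1) % 2 = H (es (n + 1)) + 1 := (es_induction n).2.1.1

theorem esLetter (n : ℕ) : EsLetter (n + 1) := (es_induction n).2.2.1

theorem H_X_add {n m : ℕ} (hm : m ≤ es (n + 1)) : H (X (n + 3) + m) = X (n + 4) + H m := by
  obtain ⟨d, e1, e2, -⟩ := ((match_X n).mono hm).map
  rw [H_zero, Nat.zero_add, Nat.zero_add] at e1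
  rw [e2, e1, H_X]

theorem p_X_add {n m : ℕ} (hm : m < es (n + 1)) : p (X (n + 3) + m) = p m := by
  rw [← match_X n m hm, Nat.zero_add]

theorem H_cs (n : ℕ) : cs (n + 1) = H (cs n) + if n % 4 = 0 then 1 else 0 := by
  induction n using Nat.strong_induction_on with
  | _ n ih =>
    match n with
    | 0 => rw [show cs 0 = 0 from rfl, H_zero]; rfl
    | 1 => rw [show cs 1 = 1 from rfl, H_one]; rfl
    | 2 => rw [show cs 2 = 2 from rfl, H_two]; rfl
    | 3 => rw [show cs 3 = X 3 from rfl, H_X]; rfl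
    | n + 4 =>
      have h1 : cs n ≤ es (n + 2) := (cs_le_es n).trans (es_mono (by omega))
      rw [cs_add_four n, H_X_add (n := n + 1) h1, show n + 4 + 1 = n + 1 + 4 by omega,
        cs_add_four, ih n (by omega), Nat.add_mod_right]
      omega

theorem H_cs_of_ne {n : ℕ} (hn : n % 4 ≠ 0) : cs (n + 1) = H (cs n) := by
  simpa [hn] using H_cs n

theorem H_cs_of_eq {n : ℕ} (hn : n % 4 = 0) : cs (n + 1) = H (cs n) + 1 := by
  rw [H_cs, if_pos hn]

/-- The letter of `p` at position `cs n`. -/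
theorem p_cs (n : ℕ) :
    (n % 4 = 0 ∧ p (cs n) = 0) ∨ (n % 4 = 1 ∧ p (cs n) = 1) ∨
    (n % 4 = 2 ∧ p (cs n) = 2) ∨ (n % 4 = 3 ∧ p (cs n) = 0) := by
  induction n with
  | zero => exact Or.inl ⟨rfl, p_zero⟩
  | succ n ih =>
    rcases ih with ⟨hn, hp⟩ | ⟨hn, hp⟩ | ⟨hn, hp⟩ | ⟨hn, hp⟩
    · have hH := H_cs_of_eq hn
      exact Or.inr (Or.inl ⟨by omega, by rw [hH, p_H_succ (by rw [hp]; decide)]⟩)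
    · have hH := H_cs_of_ne (n := n) (by omega)
      exact Or.inr (Or.inr (Or.inl ⟨by omega, by rw [hH, p_H_of_one hp]⟩))
    · have hH := H_cs_of_ne (n := n) (by omega)
      exact Or.inr (Or.inr (Or.inr ⟨by omega, by rw [hH, p_H_of_ne (by rw [hp]; decide)]⟩))
    · have hH := H_cs_of_ne (n := n) (by omega)
      exact Or.inl ⟨by omega, by rw [hH, p_H_of_ne (by rw [hp]; decide)]⟩

theorem p_cs_ne_two {n : ℕ} (hn : n % 4 ≠ 2) : p (cs n) ≠ 2 := by
  rcases p_cs n with ⟨h, e⟩ | ⟨h, e⟩ | ⟨h, e⟩ | ⟨h, e⟩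
  · rw [e]; decide
  · rw [e]; decide
  · exact absurd h hn
  · rw [e]; decide

theorem H_cs_succ_of_even {n : ℕ} (hn : n % 2 = 0) : H (cs n + 1) = cs (n + 1) + 1 := by
  rcases p_cs n with ⟨h, e⟩ | ⟨h, e⟩ | ⟨h, e⟩ | ⟨h, e⟩
  · rw [H_succ_of_ne (p_cs_ne_two (by omega)), H_cs_of_eq h]
  · omega
  · rw [H_succ_of_two e, H_cs_of_ne (by omega)]
  · omega

theorem H_cs_succ_of_odd {n : ℕ} (hn : n % 2 = 1) : H (cs n + 1) = cs (n + 1) + 2 := by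
  rw [H_succ_of_ne (p_cs_ne_two (by omega)), H_cs_of_ne (by omega)]

theorem p_cs_succ {n : ℕ} (hn : n % 2 = 1) : p (cs (n + 1) + 1) = 1 := by
  rw [H_cs_of_ne (by omega), p_H_succ (p_cs_ne_two (by omega))]

/-- The earlier block ends just before `es (n + 3)`, so `EsLetter` gives its last letter. Each
application of `h` gains one letter: on the right after a final `1`, on the left otherwise. -/
theorem match_cs (n : ℕ) :
    Match (cs (n + 1) + 1) (cs (n + 3) + 1) (cs (n + 3) - 1) := by
  induction n with
  | zero =>
    intro s hs
    have : s = 0 ∨ s = 1 ∨ s = 2 := by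
      have : cs (0 + 3) = 4 := rfl
      omega
    rcases this with rfl | rfl | rfl <;> decide
  | succ n ih =>
    have he := es_eq (n + 1)
    have he' := es_eq (n + 2)
    have hH := H_es (n + 2)
    have h3 := cs_mono (show 3 ≤ n + 3 by omega)
    have h3' := cs_mono (show 3 ≤ n + 4 by omega)
    rw [show cs 3 = 4 from rfl] at h3 h3'
    simp only [Nat.add_assoc, Nat.reduceAdd] at he he' hH ⊢
    rcases Nat.mod_two_eq_zero_or_one (n + 3) with hn | hn
    · obtain ⟨u, hu, ⟨-, hp⟩ | ⟨ho, -⟩⟩ := esLetter (n + 2)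
      swap
      · omega
      simp only [Nat.add_assoc, Nat.reduceAdd] at hu
      obtain ⟨r, hr⟩ : ∃ r, cs (n + 3) - 1 = r + 1 := ⟨cs (n + 3) - 2, by omega⟩
      rw [hr] at ih
      have hur : cs (n + 1) + 1 + r = u := by omega
      obtain ⟨d, e1, -, hd⟩ := ih.map_of_one (by rw [← ih r r.lt_succ_self, hur, hp])
      rw [H_cs_succ_of_even (by omega)] at hd e1
      rw [H_cs_succ_of_even hn] at hd
      rw [hur, ← hu] at e1
      exact hd.mono (by simp only [Nat.add_assoc, Nat.reduceAdd] at e1; omega)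
    -- Here both images begin one letter too far right; the missing letter is `1` on both sides.
    · obtain ⟨d, e1, -, hd⟩ := ih.map
      rw [H_cs_succ_of_odd (by omega)] at hd e1
      rw [H_cs_succ_of_odd hn] at hd
      rw [show cs (n + 1) + 1 + (cs (n + 3) - 1) = es (n + 3) by omega] at e1
      intro s hs
      rcases s with _ | s
      · rw [Nat.add_zero, Nat.add_zero, p_cs_succ (n := n + 1) (by omega),
          p_cs_succ (n := n + 3) hn]
      · have := hd s (by simp only [Nat.add_assoc, Nat.reduceAdd] at e1; omega)
        rwa [show cs (n + 2) + 1 + (s + 1) = cs (n + 2) + 2 + s by omega,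
          show cs (n + 4) + 1 + (s + 1) = cs (n + 4) + 2 + s by omega]

/-! ### First occurrences in `p` -/

theorem isNew_cs (n : ℕ) : IsNew (cs (n + 2)) (es (n + 2)) := by
  induction n with
  | zero =>
    intro j hj
    refine ⟨0, le_rfl, ?_⟩
    have : j = 0 ∨ j = 1 := by
      have : cs (0 + 2) = 2 := rfl
      omega
    rcases this with rfl | rfl <;> decide
  | succ n ih =>
    show IsNew (cs (n + 3)) (es (n + 3))
    have he := es_eq n
    have hH := H_es (n + 1)
    have hc := cs_le_es (n + 3)
    simp only [Nat.add_assoc, Nat.reduceAdd] at hH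
    have key : ∀ m, m < es (n + 2) ∨ (n + 2) % 2 = 0 → ∀ j, Mis j m (es (n + 2)) →
        Mis (H j) (H m) (es (n + 3)) := by
      intro m hm j hM
      obtain ⟨u, hu, ⟨hn, -⟩ | ⟨hn, hp⟩⟩ := esLetter (n + 1)
      · simp only [Nat.add_assoc, Nat.reduceAdd] at hn
        rw [show es (n + 3) = H (es (n + 2)) + 1 by omega]
        exact hM.map
      · simp only [Nat.add_assoc, Nat.reduceAdd] at hn hu
        rw [show es (n + 3) = H (es (n + 2)) by omega]
        rw [hu] at hM hm ⊢
        exact hM.map_of_zero (by omega) hp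
    -- In this case `p` has `0` at `cs (n + 2)`, and `cs (n + 3)` is the `1` of its image `01`.
    by_cases h4 : (n + 2) % 4 = 0
    · have h2 := cs_mono (show 2 ≤ n by omega)
      rw [show cs 2 = 2 from rfl] at h2
      have hC := H_cs_of_eq h4
      simp only [Nat.add_assoc, Nat.reduceAdd] at hC
      rw [hC]
      refine ih.map_succ (p_cs_ne_two (by omega)) ?_ (by omega) (key _ (by omega)) (by omega)
      rw [p_cs_succ (n := n + 1) (by omega)]
      decide
    · have hC := H_cs_of_ne h4
      simp only [Nat.add_assoc, Nat.reduceAdd] at hC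
      rw [hC]
      refine ih.map (key _ ?_) (by omega)
      -- For `n = 0` the factor is a single letter, `cs 2 = es 2`, so only the parity alternative is
      -- available.
      rcases n with _ | n
      · exact Or.inr rfl
      · have := cs_lt n
        omega

theorem p_X_sub_one (n : ℕ) : p (X (n + 2) - 1) = 1 := by
  induction n with
  | zero => exact p_one
  | succ n ih =>
    obtain ⟨m, hm⟩ : ∃ m, X (n + 2) = m + 1 := ⟨X (n + 2) - 1, by have := X_pos (n + 2); omega⟩
    rw [hm, Nat.add_sub_cancel] at ih
    have h2 : p m ≠ 2 := by rw [ih]; decide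
    show p (X (n + 3) - 1) = 1
    rw [← H_X (n + 1), hm, H_succ_of_ne h2]
    exact p_H_succ h2

theorem isNew_X (n : ℕ) : IsNew (X (n + 4) - 1) (X (n + 4) + es (n + 1)) := by
  induction n with
  | zero =>
    show IsNew 6 8
    intro j hj
    by_cases hp : p j = p 6
    · have : j = 0 ∨ j = 1 ∨ j = 2 ∨ j = 3 ∨ j = 4 ∨ j = 5 := by omega
      rcases this with rfl | rfl | rfl | rfl | rfl | rfl
      · exact absurd hp (by decide)
      · exact ⟨1, by omega, by decide⟩
      · exact absurd hp (by decide)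
      · exact ⟨2, by omega, by decide⟩
      · exact absurd hp (by decide)
      · exact absurd hp (by decide)
    · exact ⟨0, by omega, hp⟩
  | succ n ih =>
    show IsNew (X (n + 5) - 1) (X (n + 5) + es (n + 2))
    obtain ⟨m, hm⟩ : ∃ m, X (n + 4) = m + 1 := ⟨X (n + 4) - 1, by have := X_pos (n + 4); omega⟩
    have hpm := p_X_sub_one (n + 2)
    have h0 := p_X_add (n := n + 1) (m := 0) (es_pos _)
    have hHX := H_X (n + 3)
    have hHe := H_X_add (n := n + 1) (m := es (n + 1)) (es_mono (by omega))
    have hH := H_es n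
    have hpos := es_pos n
    simp only [Nat.add_assoc, Nat.reduceAdd, Nat.add_zero] at hpm h0 hHX hHe
    rw [hm, Nat.add_sub_cancel] at hpm ih
    rw [hm] at h0 hHX hHe
    have h2 : p m ≠ 2 := by rw [hpm]; decide
    -- The new start is the `1` in the image `21` of the letter `1` at `m`.
    have hX : X (n + 5) - 1 = H m + 1 := by rw [← hHX, H_succ_of_ne h2]; omega
    rw [hX]
    refine ih.map_succ h2 (by rw [h0, p_zero]; decide) (by omega) (fun j hM => ?_) (by omega)
    obtain ⟨u, hu, ⟨hn, -⟩ | ⟨hn, hp⟩⟩ := esLetter n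
    · rw [show X (n + 5) + es (n + 2) = H (m + 1 + es (n + 1)) + 1 by omega]
      exact hM.map
    · rw [show X (n + 5) + es (n + 2) = H (m + 1 + es (n + 1)) by omega]
      rw [hu, ← Nat.add_assoc] at hM ⊢
      refine hM.map_of_zero (by omega) ?_
      have := p_X_add (n := n + 1) (m := u) (by
        have := es_mono (show n + 1 ≤ n + 2 by omega)
        simp only [Nat.add_assoc, Nat.reduceAdd]
        omega)
      simp only [Nat.add_assoc, Nat.reduceAdd] at this
      rw [← hm, this, hp]

/-! ### Earlier occurrences of short factors -/

theorem exists_level {k m : ℕ} (hk : X (k + 3) ≤ m) :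
    ∃ q, k ≤ q ∧ X (q + 3) ≤ m ∧ m < X (q + 4) := by
  classical
  have hex : ∃ q, m < X (q + 4) := ⟨m, by
    have : m + 4 ≤ X (m + 4) := add_le_X (m + 3)
    omega⟩
  have hlt := Nat.find_spec hex
  have hkq : k ≤ Nat.find hex := by
    by_contra! hc
    have := X_succ_mono (show Nat.find hex + 3 ≤ k + 2 by omega)
    simp only [Nat.add_assoc, Nat.reduceAdd] at this
    omega
  refine ⟨Nat.find hex, hkq, ?_, hlt⟩
  rcases Nat.eq_or_lt_of_le hkq with h | h
  · rwa [← h]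
  · have := Nat.find_min hex (m := Nat.find hex - 1) (by omega)
    rw [show Nat.find hex - 1 + 4 = Nat.find hex + 3 by omega] at this
    omega

/-- Drop letters from the block of `match_cs` until it starts at `m`. It reaches up to `X (q + 4) +
es (q + 1)`, leaving at least `es (q + 1) + 1` letters. -/
theorem exists_match_of_cs_lt {q m n : ℕ} (h1 : cs (q + 3) < m) (h2 : m < X (q + 4))
    (hn : n ≤ es (q + 1) + 1) : ∃ j < m, Match j m n := by
  have hlt := cs_mono (show q + 1 ≤ q + 3 by omega)
  have h2' := two_mul_cs q
  have hM := (match_cs q).drop (m - cs (q + 3) - 1)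
  rw [show cs (q + 3) + 1 + (m - cs (q + 3) - 1) = m by omega] at hM
  refine ⟨_, ?_, hM.mono (by omega)⟩
  have := cs_lt (q + 1)
  have := cs_lt (q + 2)
  simp only [Nat.add_assoc, Nat.reduceAdd] at *
  omega

theorem exists_match_of_X_le {k m n : ℕ} (hk : X (k + 3) ≤ m) (hn : n ≤ cs (k + 1)) :
    ∃ j < m, Match j m n := by
  obtain ⟨q, hkq, h1, h2⟩ := exists_level hk
  have hn' : n ≤ cs (q + 1) := hn.trans (cs_mono (by omega))
  rcases Nat.lt_or_ge (cs (q + 3)) m with h | h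
  · exact exists_match_of_cs_lt h h2 (hn'.trans ((cs_le_es _).trans (Nat.le_succ _)))
  -- The copied prefix ends before `es (q + 3) = cs (q + 3) + cs (q + 1)`, so at least `cs (q + 1)`
  -- letters remain.
  · have hM := (match_X q).drop (m - X (q + 3))
    rw [show X (q + 3) + (m - X (q + 3)) = m by omega] at hM
    have hX := X_pos (q + 3)
    have he := es_eq (q + 1)
    have he' := es_add_two (q + 1)
    simp only [Nat.add_assoc, Nat.reduceAdd] at he he'
    exact ⟨_, by omega, hM.mono (by omega)⟩

theorem exists_match_of_cs_lt' {k m n : ℕ} (hk : cs (k + 3) < m) (hn : n ≤ es (k + 1) + 1) :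
    ∃ j < m, Match j m n := by
  rcases Nat.lt_or_ge m (X (k + 4)) with h | h
  · exact exists_match_of_cs_lt hk h hn
  · exact exists_match_of_X_le (k := k + 1) h (hn.trans (es_lt_cs (k + 1)))

/-! ### Values of the appearance function -/

/-- Any start beyond `M` can be moved left repeatedly until it is at most `M`, while the factor at
`M` itself has no earlier occurrence. -/
theorem appearance_eq {M n e : ℕ} (hM : 0 < M) (hup : ∀ m, M < m → ∃ j < m, Match j m n)
    (hnew : IsNew M e) (he : e < M + n) : appearance p n = M := by
  refine (isLeast_appearance p n).unique ⟨⟨hM, fun i => ?_⟩, fun M' hM' => ?_⟩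
  · induction i using Nat.strong_induction_on with
    | _ i ih =>
      rcases Nat.lt_or_ge M i with h | h
      · obtain ⟨j, hj, hm⟩ := hup i h
        obtain ⟨j', hj', hf⟩ := ih j hj
        exact ⟨j', hj', hf.trans hm.factor_eq⟩
      · exact ⟨i, h, rfl⟩
  · by_contra! hlt
    obtain ⟨j, hj, hf⟩ := hM'.2 M
    obtain ⟨t, ht, hne⟩ := hnew j (by omega)
    exact hne (match_of_factor_eq hf t (by omega))

theorem appearance_eq_X {k n : ℕ} (h1 : es (k + 1) + 1 < n) (h2 : n ≤ cs (k + 2)) :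
    appearance p n = X (k + 4) - 1 := by
  have hX := add_le_X (k + 3)
  simp only [Nat.add_assoc, Nat.reduceAdd] at hX
  exact appearance_eq (by omega)
    (fun m hm => exists_match_of_X_le (k := k + 1)
      (show X (k + 4) ≤ m by omega) h2) (isNew_X k) (by omega)

theorem appearance_eq_cs {k n : ℕ} (h1 : cs (k + 1) < n) (h2 : n ≤ es (k + 1) + 1) :
    appearance p n = cs (k + 3) := by
  have he := es_eq (k + 1)
  simp only [Nat.add_assoc, Nat.reduceAdd] at he
  have := cs_lt (k + 2)
  exact appearance_eq (Nat.zero_lt_of_lt this) (fun m hm => exists_match_of_cs_lt' hm h2)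
    (isNew_cs (k + 1)) (by simp only [Nat.add_assoc, Nat.reduceAdd]; omega)

theorem appearance_one : appearance p 1 = 2 := by
  refine appearance_eq (by decide) (fun m hm => ?_) (isNew_cs 0) (by decide)
  -- The general bound begins at `X 3 = 4`, so position 3 is matched with position 1 by hand.
  rcases Nat.eq_or_lt_of_le (Nat.succ_le_of_lt hm) with rfl | h
  · refine ⟨1, by decide, fun s hs => ?_⟩
    obtain rfl : s = 0 := by omega
    decide
  · exact exists_match_of_X_le (k := 0) h le_rfl

/-! ### From digit words to `es` and `cs` -/

theorem wpow_succ (w : List ℕ) (i : ℕ) : wpow w (i + 1) = w ++ wpow w i := by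
  simp [wpow, List.replicate_succ]

theorem length_wpow (w : List ℕ) (i : ℕ) : (wpow w i).length = i * w.length := by
  simp [wpow]

theorem B_odd_eq (i : ℕ) : B (2 * i + 3) = es (2 * i + 3) + 1 := by
  rw [B_odd]
  induction i with
  | zero => rfl
  | succ i ih =>
    rw [show 2 * (i + 1) + 3 = 2 * i + 3 + 2 by omega, es_add_two, Nat.add_assoc, ← ih, wpow_succ]
    simp [valP, length_wpow]
    ring_nf

/-- The digits end with `X 3` where `es` ends with `X 2`, hence the excess 2; for odd indices `X 2`
replaces `X 1`. So an odd `B` closes a range with value in `C`, while an even `B` opens the next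
one. -/
theorem B_even_eq (i : ℕ) : B (2 * i + 4) = es (2 * i + 4) + 2 := by
  rw [B_even]
  induction i with
  | zero => rfl
  | succ i ih =>
    rw [show 2 * (i + 1) + 4 = 2 * i + 4 + 2 by omega, es_add_two, Nat.add_assoc, ← ih, wpow_succ]
    simp [valP, length_wpow]
    ring_nf

theorem valP_wpow_eq (v : List ℕ) (hv : valP ([1, 0] ++ v) = cs (v.length + 2)) (i : ℕ) :
    valP ([1, 0] ++ wpow [0, 0, 1, 0] i ++ v) = cs (4 * i + v.length + 2) := by
  induction i with
  | zero => simpa [wpow] using hv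
  | succ i ih =>
    rw [show 4 * (i + 1) + v.length + 2 = 4 * i + v.length + 2 + 4 by omega, cs_add_four, ← ih,
      wpow_succ]
    simp [valP, length_wpow]
    ring_nf

theorem C_eq (n : ℕ) : C (n + 2) = cs (n + 2) := by
  have h4 : n % 4 < 4 := Nat.mod_lt _ (by decide)
  obtain ⟨i, hi⟩ : ∃ i, n = 4 * i + n % 4 := ⟨n / 4, (Nat.div_add_mod n 4).symm⟩
  interval_cases n % 4
  · subst hi
    simpa [C_two] using valP_wpow_eq [] rfl i
  · subst hi
    simpa [C_three] using valP_wpow_eq [0] rfl i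
  · subst hi
    simpa [C_four] using valP_wpow_eq [0, 0] rfl i
  · subst hi
    simpa [C_five] using valP_wpow_eq [0, 0, 1] rfl i

theorem exists_B_lt_le {n : ℕ} (hn : 7 ≤ n) : ∃ i, B (2 * i + 3) < n ∧ n ≤ B (2 * i + 5) := by
  classical
  have hB : ∀ i, B (2 * i + 5) = es (2 * i + 5) + 1 := fun i => B_odd_eq (i + 1)
  have hex : ∃ i, n ≤ B (2 * i + 5) := by
    refine ⟨n, ?_⟩
    have h1 := add_le_X (2 * n + 4)
    have h2 := (X_le_cs (2 * n + 4)).trans (cs_le_es _)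
    rw [hB]
    simp only [Nat.add_assoc, Nat.reduceAdd] at h1 h2
    omega
  refine ⟨Nat.find hex, ?_, Nat.find_spec hex⟩
  rcases Nat.eq_zero_or_pos (Nat.find hex) with h | h
  · rw [h]
    have : B (2 * 0 + 3) = 6 := by decide
    omega
  · have := Nat.find_min hex (m := Nat.find hex - 1) (by omega)
    rw [show 2 * (Nat.find hex - 1) + 5 = 2 * Nat.find hex + 3 by omega] at this
    omega

end PWord

theorem theorem11 :
    appearance p 1 = 2 ∧
    appearance p 2 = 4 ∧
    appearance p 3 = 7 ∧
    appearance p 4 = 11 ∧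
    appearance p 5 = 13 ∧
    appearance p 6 = 13 ∧
    (∀ i n : ℕ, 1 ≤ i →
      (B (2 * i + 1) < n ∧ n ≤ C (2 * i + 2) → appearance p n = X (2 * i + 4) - 1) ∧
      (C (2 * i + 2) < n ∧ n < B (2 * i + 2) → appearance p n = C (2 * i + 4)) ∧
      (B (2 * i + 2) ≤ n ∧ n ≤ C (2 * i + 3) → appearance p n = X (2 * i + 5) - 1) ∧
      (C (2 * i + 3) < n ∧ n ≤ B (2 * i + 3) → appearance p n = C (2 * i + 5))) ∧
    (∀ n : ℕ, 7 ≤ n → ∃ i : ℕ, 1 ≤ i ∧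
      ((B (2 * i + 1) < n ∧ n ≤ C (2 * i + 2)) ∨
       (C (2 * i + 2) < n ∧ n < B (2 * i + 2)) ∨
       (B (2 * i + 2) ≤ n ∧ n ≤ C (2 * i + 3)) ∨
       (C (2 * i + 3) < n ∧ n ≤ B (2 * i + 3)))) := by
  refine ⟨appearance_one, appearance_eq_cs (k := 0) (by decide) (by decide),
    appearance_eq_cs (k := 1) (by decide) (by decide),
    appearance_eq_X (k := 1) (by decide) (by decide),
    appearance_eq_cs (k := 2) (by decide) (by decide),
    appearance_eq_cs (k := 2) (by decide) (by decide), fun i n hi => ?_, fun n hn => ?_⟩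
  · obtain ⟨i, rfl⟩ : ∃ r, i = r + 1 := ⟨i - 1, by omega⟩
    have hB1 : B (2 * (i + 1) + 1) = es (2 * i + 2 + 1) + 1 := B_odd_eq i
    have hB2 : B (2 * (i + 1) + 2) = es (2 * i + 3 + 1) + 2 := B_even_eq i
    have hB3 : B (2 * (i + 1) + 3) = es (2 * i + 4 + 1) + 1 := B_odd_eq (i + 1)
    have hC2 : C (2 * (i + 1) + 2) = cs (2 * i + 3 + 1) := C_eq _
    have hC3 : C (2 * (i + 1) + 3) = cs (2 * i + 4 + 1) := C_eq (2 * i + 3)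
    have hC4 : C (2 * (i + 1) + 4) = cs (2 * i + 3 + 3) := C_eq (2 * i + 4)
    have hC5 : C (2 * (i + 1) + 5) = cs (2 * i + 4 + 3) := C_eq (2 * i + 5)
    rw [hB1, hB2, hB3, hC2, hC3, hC4, hC5]
    exact ⟨fun h => appearance_eq_X h.1 h.2,
      fun h => appearance_eq_cs h.1 (by omega),
      fun h => appearance_eq_X (k := 2 * i + 3) (by omega) h.2,
      fun h => appearance_eq_cs h.1 h.2⟩
  · obtain ⟨i, h1, h2⟩ := exists_B_lt_le hn
    refine ⟨i + 1, by omega, ?_⟩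
    rw [show 2 * (i + 1) + 1 = 2 * i + 3 by omega, show 2 * (i + 1) + 3 = 2 * i + 5 by omega]
    omega
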